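/- **Model.** Consider a fully connected network of nodes with one duplex port each: in every round a node may send one message to at most one other node and receive one message from at most one other node. Data are vectors over a field $F$; each symbol consists of $q \ge 1$ units (elements of $F$), and messages can be cut between units. What a node sends is a list of $F$-linear combinations, fixed in advance, of the units it holds when the round starts. For $\alpha,\beta\ge 0$, a scheme with $C_1$ rounds in which the largest message of round $i$ has $b_i$ symbols (i.e. $q b_i$ units) costs $C_1\alpha+\sum_{i=1}^{C_1} b_i\beta$. *Multi-reduce$(p,r,n)$* with $r<p$: there are $p$ data nodes holding blocks $M_1,\dots,M_p$ of $n$ symbols each, and $r$ further reduction nodes, which hold nothing; at the end the $i$-th reduction node must have $a_{i,1}M_1+\cdots+a_{i,p}M_p$, for prescribed $a_{i,j}\in F$ (for example the parities of an MDS code). *Multi-broadcast$(p,r,n)$*: there are $r$ broadcasting nodes holding blocks of $n$ symbols each, and $p$ further destination nodes, which hold nothing; at the end all destination nodes must have all $r$ blocks. **Theorem.** 1. For all integers $0\le r<p$ there is an integer $d=d(p,r)\ge 1$ such that for all $F$, $n$, $q$ with $d\mid nq$, all $\alpha,\beta\ge0$ and all coefficients $a_{i,j}\in F$, multi-reduce$(p,r,n)$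 can be done with cost at most $$2\left(\lceil\log_2 p\rceil\,\alpha+rn\beta\right).$$ 2. Let $p=rs$ with $r\ge 1$, $s\ge 2$, and divide the $p$ data (destination) nodes into $r$ groups of size $s$, group $j$ being assigned to the $j$-th reduction (broadcasting) node. Again there is $d=d(r,s)\ge1$ such that, whenever $d\mid nq$ and $\alpha,\beta\ge 0$, there are schemes $A$, $R$, $B$, not depending on the coefficients, where $A$ is an all-gather across the groups (for every $k$, the $k$-th nodes of the $r$ groups exchange their blocks among themselves so that each of them has all $r$ blocks), $R$ is a reduce within each group (every reduction node obtains the sum of the $s$ blocks of its group, by communication inside the group and with this node only), $B$ is a broadcast within each group (every broadcasting node sends its block to all nodes of its group, by communication inside the group and with this node only), and the communication pattern of $R$ is that of $B$ with the order of the rounds and all directions of transmission reversed. Running $B$ and then $A$ performs multi-broadcast$(p,r,n)$. For all coefficients, running $A$ and then $R$, where for $R$ each node of group $j$ replaces its block by the part of the combination wanted at reduction node $j$ that involves the $r$ blocks it has gathered, performs multi-reduce$(p,r,n)$. Both have cost at most $2(\lceil\log_2 p\rceil\alpha+rn\beta)$. 3. (Corollary.) Let $K<P<2K$. There is $d=d(P,K)\ge1$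 such that for all $\alpha,\beta\ge0$, every $N$ divisible by $K$ and every $q\ge1$ with $d\mid (N/K)q$, every $(P,K)$ systematic MDS code over $F$ (generator matrix $[I_K\mid \mathcal P]$, any $K$ columns linearly independent), with $N/K$ data symbols at each of the $K$ systematic nodes and $P-K$ further parity nodes holding nothing, can be encoded (every node obtains its block of the codeword) with cost at most $$2\left(\lceil\log_2 K\rceil\,\alpha+(P-K)\frac NK\beta\right).$$ -/

import Mathlib

namespace CommScheme

/-! A fully connected network with node set `V`. The global data is a vector `x` of an `F`-vector
space `X`; every transmitted unit is the value `f x` of a linear functional `f` on `X` that is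
fixed in advance, and nodes may carry out arbitrary linear computations on what they hold. -/

/-- `m` units (elements of `F`) for each index in `ι`: the block `x i` belongs to index `i`. -/
abbrev Data (F ι : Type*) (m : ℕ) := ι → Fin m → F

/-- The `k`-th unit of the `i`-th block, as a functional of the global data. -/
def coord (F : Type*) [Field F] {ι : Type*} {m : ℕ} (i : ι) (k : Fin m) :
    Module.Dual F (Data F ι m) :=
  LinearMap.proj k ∘ₗ LinearMap.proj i

/-- One round: `R v w` is the list of units that `v` sends to `w`
(the empty list if `v` does not send to `w`). -/
abbrev Round (V F X : Type*) [Field F] [AddCommGroup X] [Module F X] :=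
  V → V → List (Module.Dual F X)

/-- A scheme is the sequence of its rounds. -/
abbrev Scheme (V F X : Type*) [Field F] [AddCommGroup X] [Module F X] :=
  List (Round V F X)

/-- For every node the space of functionals of the global data whose value the node can compute. -/
abbrev Knowledge (V F X : Type*) [Field F] [AddCommGroup X] [Module F X] :=
  V → Submodule F (Module.Dual F X)

section

variable {V F X Y : Type*} [Field F] [AddCommGroup X] [Module F X] [AddCommGroup Y] [Module F Y]

/-- The number of units sent from `v` to `w` in a round. -/
def load (R : Round V F X) : V → V → ℕ := fun v w => (R v w).length

/-- The loads of all rounds of a scheme, in order. -/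
def loads (S : Scheme V F X) : List (V → V → ℕ) := S.map load

/-- Reversal of a communication pattern: the rounds in reverse order, every transmission in the
opposite direction. -/
def reverseLoads (L : List (V → V → ℕ)) : List (V → V → ℕ) :=
  (L.map fun b => fun v w => b w v).reverse

/-- One duplex port: in a round, a node sends to at most one node and receives from at most one
node, both different from itself. -/
def OnePort (R : Round V F X) : Prop :=
  (∀ v, R v v = []) ∧
  (∀ v w w', R v w ≠ [] → R v w' ≠ [] → w = w') ∧
  (∀ v v' w, R v w ≠ [] → R v' w ≠ [] → v = v')

/-- What the nodes know after a round. -/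
def learn (W : Knowledge V F X) (R : Round V F X) : Knowledge V F X :=
  fun w => W w ⊔ ⨆ v, Submodule.span F {f | f ∈ R v w}

/-- What the nodes know after all rounds. -/
def final (W : Knowledge V F X) (S : Scheme V F X) : Knowledge V F X := S.foldl learn W

/-- From the initial knowledge `W` the scheme can be carried out: every round obeys the port
constraint, and every unit is computed from what its sender knows when the round starts. -/
def Valid : Knowledge V F X → Scheme V F X → Prop
  | _, [] => True
  | W, R :: S => OnePort R ∧ (∀ v w, ∀ f ∈ R v w, f ∈ W v) ∧ Valid (learn W R) S

/-- The scheme can be carried out from the initial knowledge `W`, and at its end every node `v`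
can compute all of `goal v`. -/
def Performs (W : Knowledge V F X) (goal : V → Set (Module.Dual F X)) (S : Scheme V F X) : Prop :=
  Valid W S ∧ ∀ v, ∀ f ∈ goal v, f ∈ final W S v

/-- All transmissions are between nodes related by `rel`. -/
def Within (rel : V → V → Prop) (S : Scheme V F X) : Prop :=
  ∀ R ∈ S, ∀ v w, R v w ≠ [] → rel v w

/-- The same scheme, run on the data `φ x` instead of `x`. -/
def onData (φ : X →ₗ[F] Y) (S : Scheme V F Y) : Scheme V F X :=
  S.map fun R => fun v w => (R v w).map fun f => f ∘ₗ φ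

/-- The largest number of units sent between two nodes in a round. -/
def maxLoad [Fintype V] (b : V → V → ℕ) : ℕ :=
  Finset.univ.sup fun v => Finset.univ.sup fun w => b v w

/-- Cost in the `α`-`β` model, one symbol being `q` units: a round with largest message `b` units
costs `α + (b / q) β`. -/
noncomputable def cost [Fintype V] (α β : ℝ) (q : ℕ) (S : Scheme V F X) : ℝ :=
  ((loads S).map fun b => α + (maxLoad b : ℝ) / q * β).sum

end

/-! The communication problems. The nodes are `ι ⊕ κ`: data (or destination) nodes `inl i` and
reduction (or broadcasting) nodes `inr j`. -/

section

variable {F : Type*} [Field F] {ι κ : Type*} {m : ℕ}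

/-- Node `inl i` holds block `i`; the nodes `inr j` hold nothing. -/
def dataAtLeft : Knowledge (ι ⊕ κ) F (Data F ι m)
  | Sum.inl i => Submodule.span F (Set.range (coord F i))
  | Sum.inr _ => ⊥

/-- Node `inr j` holds block `j`; the nodes `inl i` hold nothing. -/
def dataAtRight : Knowledge (ι ⊕ κ) F (Data F κ m)
  | Sum.inl _ => ⊥
  | Sum.inr j => Submodule.span F (Set.range (coord F j))

/-- The units of the block `∑ i, c i • x i`. -/
def combination [Fintype ι] (c : ι → F) : Set (Module.Dual F (Data F ι m)) :=
  Set.range fun k : Fin m => ∑ i, c i • coord F i k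

/-- Multi-reduce: reduction node `j` gets `∑ i, a j i • x i`. -/
def MultiReduce [Fintype ι] (a : κ → ι → F) (S : Scheme (ι ⊕ κ) F (Data F ι m)) : Prop :=
  Performs dataAtLeft (Sum.elim (fun _ => ∅) fun j => combination (a j)) S

/-- Multi-broadcast: every destination node gets all the blocks of the broadcasting nodes. -/
def MultiBroadcast (S : Scheme (ι ⊕ κ) F (Data F κ m)) : Prop :=
  Performs dataAtRight
    (Sum.elim (fun _ => {f | ∃ (j : κ) (k : Fin m), f = coord F j k}) fun _ => ∅) S

end

/-! `r` groups of `s` data nodes: data node `(j, k)` is the `k`-th node of the `j`-th group, and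
group `j` belongs to the reduction (broadcasting) node `j`. -/

section

variable {F : Type*} [Field F] {r s m : ℕ}

/-- The group that a node belongs to. -/
def groupOf : (Fin r × Fin s) ⊕ Fin r → Fin r :=
  Sum.elim Prod.fst id

/-- Both nodes are data nodes, and they have the same position within their groups. -/
def SamePosition (v w : (Fin r × Fin s) ⊕ Fin r) : Prop :=
  ∃ j j' k, v = Sum.inl (j, k) ∧ w = Sum.inl (j', k)

/-- All-gather across the groups: the `k`-th nodes of the `r` groups share their blocks, by
transmissions among themselves only. -/
def AllGatherAcross (S : Scheme ((Fin r × Fin s) ⊕ Fin r) F (Data F (Fin r × Fin s) m)) : Prop :=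
  Within SamePosition S ∧
  Performs dataAtLeft
    (Sum.elim (fun i => {f | ∃ (j : Fin r) (k : Fin m), f = coord F (j, i.2) k}) fun _ => ∅) S

/-- Reduce within each group: reduction node `j` gets the sum of the blocks of group `j`, by
transmissions among itself and the nodes of group `j` only. -/
def ReduceWithin (S : Scheme ((Fin r × Fin s) ⊕ Fin r) F (Data F (Fin r × Fin s) m)) : Prop :=
  Within (fun v w => groupOf v = groupOf w) S ∧
  Performs dataAtLeft
    (Sum.elim (fun _ => ∅) fun j => combination fun i => if i.1 = j then 1 else 0) S

/-- Broadcast within each group: all nodes of group `j` get the block of broadcasting node `j`,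
by transmissions among itself and the nodes of group `j` only. -/
def BroadcastWithin (S : Scheme ((Fin r × Fin s) ⊕ Fin r) F (Data F (Fin r) m)) : Prop :=
  Within (fun v w => groupOf v = groupOf w) S ∧
  Performs dataAtRight
    (Sum.elim (fun i => Set.range (coord F i.1)) fun _ => ∅) S

/-- The local computation before the reduce: node `(j, k)`, which holds the blocks of the `k`-th
nodes of all groups, forms the part of the `j`-th combination that involves these blocks. -/
def partialCombination (a : Fin r → Fin r × Fin s → F) :
    Data F (Fin r × Fin s) m →ₗ[F] Data F (Fin r × Fin s) m :=
  LinearMap.pi fun i => ∑ j : Fin r, a i.1 (j, i.2) • LinearMap.proj (j, i.2)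

/-- After the broadcast, the block at node `(j, k)` is the block of broadcasting node `j`. -/
def copyToGroup : Data F (Fin r) m →ₗ[F] Data F (Fin r × Fin s) m :=
  LinearMap.pi fun i => LinearMap.proj i.1

end

/-- `G` generates a systematic MDS code with `Fin K` as systematic positions: it is `[I | A]`, and
any `K` of its columns are linearly independent. -/
def IsSystematicMDS {F : Type*} [Field F] {K t : ℕ} (G : Matrix (Fin K) (Fin K ⊕ Fin t) F) : Prop :=
  (∀ i j, G i (Sum.inl j) = if i = j then 1 else 0) ∧
  ∀ T : Finset (Fin K ⊕ Fin t), T.card = K → LinearIndependent F fun v : T => G.col v.1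

/-- Distributed encoding: node `v` gets its codeword block `∑ i, G i v • x i`. -/
def Encodes {F : Type*} [Field F] {K t m : ℕ} (G : Matrix (Fin K) (Fin K ⊕ Fin t) F)
    (S : Scheme (Fin K ⊕ Fin t) F (Data F (Fin K) m)) : Prop :=
  Performs dataAtLeft (fun v => combination fun i => G i v) S

end CommScheme

open CommScheme

/-!
A schedule that only forwards units is a routing problem on their labels, and it can be reversed.
Transpose its rounds, in reverse order, and let every node keep a partial sum for every unit: when
a node received the unit in the original round, it now passes its partial sum on to the node it
received the unit from, and continues with zero. A node receives from at most one node in a round,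
so the total of the partial sums over all nodes is preserved (`sum_passOn`), while the nodes with a
nonzero partial sum shrink to those that held the unit in the original schedule
(`mem_of_passOn_ne_zero`), at last to its source. Hence a broadcast turns into a reduction with
arbitrary coefficients and with exactly the reversed communication pattern
(`performs_collect_reverse`, `loads_collect_reverse`), and it remains to construct broadcasts.

Two schedules with few rounds and little traffic are needed. In the cyclic all-gather
(`feasible_gather`), each of `p` nodes receives `p - 1` pieces in `⌈log₂ p⌉` rounds, the amount
held doubling in each round. The scatter along a binomial tree (`feasible_scatter`) brings `s`
distinct pieces from one node to `s` others in `⌈log₂ (s + 1)⌉` rounds, and the largest messages of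
its rounds sum to `s` pieces.

For the multi-broadcast from `r` sources to `p` nodes put `s = ⌊(p - 1) / r⌋`. Each source cuts its
block into `s` pieces and scatters them over `s` nodes of its own; the `p` nodes then perform an
all-gather (`exists_spread`). As `s + 1 ≤ p`, there are at most `2 ⌈log₂ p⌉` rounds, and the
largest messages sum to `s + (p - 1) ≤ 2 * r * s` pieces, which is `2 * r` blocks.

For `p = r * s` the same construction with one source is run within every group; as it uses
`s - 1` pieces, it takes `2 ⌈log₂ s⌉` rounds and `2` blocks. The all-gather across the groups adds
`⌈log₂ r⌉` rounds and `r - 1` blocks, within the bound by `clog_add_two_mul_clog_le`. Encoding a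
systematic code is a multi-reduce for the parity nodes.
-/

namespace CommScheme

/-! ### Routing schedules -/

/-- A round of a routing schedule: `R v w` is the set of (labels of) units that `v` forwards
to `w`. -/
abbrev Transfer (V U : Type*) := V → V → Finset U

section Routing

variable {V U : Type*}

/-- The duplex port constraint for a round of a routing schedule. -/
def Transfer.OnePort (R : Transfer V U) : Prop :=
  (∀ v, R v v = ∅) ∧
  (∀ v w w', (R v w).Nonempty → (R v w').Nonempty → w = w') ∧
  (∀ v v' w, (R v w).Nonempty → (R v' w).Nonempty → v = v')

/-- The largest number of units forwarded between two nodes. -/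
def Transfer.width [Fintype V] (R : Transfer V U) : ℕ := maxLoad fun v w => (R v w).card

theorem Transfer.width_le [Fintype V] {R : Transfer V U} {b : ℕ} (h : ∀ v w, (R v w).card ≤ b) :
    R.width ≤ b :=
  Finset.sup_le fun v _ => Finset.sup_le fun w _ => h v w

theorem Transfer.card_le_width [Fintype V] (R : Transfer V U) (v w : V) :
    (R v w).card ≤ R.width :=
  (Finset.le_sup (f := fun w => (R v w).card) (Finset.mem_univ w)).trans
    (Finset.le_sup (f := fun v => Finset.univ.sup fun w => (R v w).card) (Finset.mem_univ v))

/-- Initially, the unit `u` is held by the node `src u` only. -/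
def origin (src : U → V) : V → Set U := fun v => {u | v = src u}

/-- The units held after a round, if `H` describes the units held before it. -/
def hold (H : V → Set U) (R : Transfer V U) : V → Set U :=
  fun w => {u | u ∈ H w ∨ ∃ v, u ∈ R v w}

/-- The units held after all rounds of a routing schedule. -/
def held (H : V → Set U) (Rs : List (Transfer V U)) : V → Set U := Rs.foldl hold H

/-- Every round obeys the port constraint, and only units that are held are forwarded. -/
def Feasible : (V → Set U) → List (Transfer V U) → Prop
  | _, [] => True
  | H, R :: Rs => R.OnePort ∧ (∀ v w, ∀ u ∈ R v w, u ∈ H v) ∧ Feasible (hold H R) Rs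

theorem held_append (H : V → Set U) (Rs Rs' : List (Transfer V U)) :
    held H (Rs ++ Rs') = held (held H Rs) Rs' := List.foldl_append

theorem feasible_append {H : V → Set U} {Rs Rs' : List (Transfer V U)} :
    Feasible H (Rs ++ Rs') ↔ Feasible H Rs ∧ Feasible (held H Rs) Rs' := by
  induction Rs generalizing H with
  | nil => simp [Feasible, held]
  | cons R Rs ih => simp [Feasible, held, ih, and_assoc]

end Routing

/-! ### Pulling back schedules -/

section Pull

variable {V U V' U' J : Type*} [Fintype U'] [DecidableEq J] [DecidableEq U]

/-- Copies of a round run in parallel: the node `v` plays the role `pos v` in the copy `grp v`, and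
the unit `u` plays the role `lab u` in the copy `cls u`. Nodes whose copy contains no unit stay
idle. -/
def Transfer.pull (grp : V' → J) (pos : V' → V) (cls : U' → J) (lab : U' → U)
    (R : Transfer V U) : Transfer V' U' :=
  fun v w => Finset.univ.filter fun u =>
    grp v = cls u ∧ grp w = cls u ∧ lab u ∈ R (pos v) (pos w)

variable {grp : V' → J} {pos : V' → V} {cls : U' → J} {lab : U' → U}

theorem Transfer.mem_pull {R : Transfer V U} {v w : V'} {u : U'} :
    u ∈ R.pull grp pos cls lab v w ↔
      grp v = cls u ∧ grp w = cls u ∧ lab u ∈ R (pos v) (pos w) := by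
  simp [Transfer.pull]

theorem Transfer.OnePort.pull {R : Transfer V U} (hR : R.OnePort)
    (inj : ∀ v w u, grp v = cls u → grp w = cls u → pos v = pos w → v = w) :
    (R.pull grp pos cls lab).OnePort := by
  refine ⟨fun v => ?_, ?_, ?_⟩
  · ext u
    simp [Transfer.mem_pull, hR.1]
  · rintro v w w' ⟨u, hu⟩ ⟨u', hu'⟩
    rw [Transfer.mem_pull] at hu hu'
    exact inj w w' u hu.2.1 (hu'.2.1.trans (hu'.1.symm.trans hu.1))
      (hR.2.1 _ _ _ ⟨_, hu.2.2⟩ ⟨_, hu'.2.2⟩)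
  · rintro v v' w ⟨u, hu⟩ ⟨u', hu'⟩
    rw [Transfer.mem_pull] at hu hu'
    exact inj v v' u hu.1 (hu'.1.trans (hu'.2.1.symm.trans hu.2.1))
      (hR.2.2 _ _ _ ⟨_, hu.2.2⟩ ⟨_, hu'.2.2⟩)

theorem Transfer.width_pull_le [Fintype V] [Fintype V'] (R : Transfer V U) {b : ℕ}
    (hb : ∀ j x, (Finset.univ.filter fun u => cls u = j ∧ lab u = x).card ≤ b) :
    (R.pull grp pos cls lab).width ≤ b * R.width := by
  refine Transfer.width_le fun v w => ?_
  have h1 : (R.pull grp pos cls lab v w).card ≤ b * (R (pos v) (pos w)).card := by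
    refine Finset.card_le_mul_card_image_of_maps_to (f := lab)
      (fun u hu => (Transfer.mem_pull.1 hu).2.2) b fun x _ => (Finset.card_le_card ?_).trans
        (hb (grp v) x)
    intro u hu
    simp only [Finset.mem_filter, Transfer.mem_pull, Finset.mem_univ, true_and] at hu ⊢
    exact ⟨hu.1.1.symm, hu.2⟩
  exact h1.trans (Nat.mul_le_mul_left b (R.card_le_width _ _))

/-- In every copy that contains a unit, the nodes are in bijection with the original ones. -/
structure IsCopy (grp : V' → J) (pos : V' → V) (cls : U' → J) : Prop where
  inj : ∀ v w u, grp v = cls u → grp w = cls u → pos v = pos w → v = w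
  surj : ∀ x u, ∃ v, grp v = cls u ∧ pos v = x

theorem held_pull (hc : IsCopy grp pos cls) {Rs : List (Transfer V U)} {H : V → Set U}
    {H' : V' → Set U'} (hH : ∀ v u, grp v = cls u → lab u ∈ H (pos v) → u ∈ H' v)
    (v : V') (u : U') (hv : grp v = cls u) (hu : lab u ∈ held H Rs (pos v)) :
    u ∈ held H' (Rs.map (Transfer.pull grp pos cls lab)) v := by
  induction Rs generalizing H H' with
  | nil => exact hH v u hv hu
  | cons R Rs ih =>
    refine ih (H := hold H R) (fun w x hw hx => ?_) hu
    rcases hx with hx | ⟨y, hy⟩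
    · exact Or.inl (hH w x hw hx)
    · obtain ⟨y', hy', rfl⟩ := hc.surj y x
      exact Or.inr ⟨y', Transfer.mem_pull.2 ⟨hy', hw, hy⟩⟩

theorem Feasible.pull (hc : IsCopy grp pos cls) {Rs : List (Transfer V U)} {H : V → Set U}
    {H' : V' → Set U'} (hH : ∀ v u, grp v = cls u → lab u ∈ H (pos v) → u ∈ H' v)
    (hF : Feasible H Rs) : Feasible H' (Rs.map (Transfer.pull grp pos cls lab)) := by
  induction Rs generalizing H H' with
  | nil => trivial
  | cons R Rs ih =>
    refine ⟨hF.1.pull hc.inj, fun v w u hu => ?_, ih (fun w x hw hx => ?_) hF.2.2⟩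
    · have := Transfer.mem_pull.1 hu
      exact hH v u this.1 (hF.2.1 _ _ _ this.2.2)
    · exact held_pull hc (Rs := [R]) hH w x hw hx

theorem sum_width_pull_le [Fintype V] [Fintype V'] (Rs : List (Transfer V U)) {b : ℕ}
    (hb : ∀ j x, (Finset.univ.filter fun u => cls u = j ∧ lab u = x).card ≤ b) :
    ((Rs.map (Transfer.pull grp pos cls lab)).map Transfer.width).sum ≤
      b * (Rs.map Transfer.width).sum := by
  induction Rs with
  | nil => simp
  | cons R Rs ih =>
    simp only [List.map_cons, List.sum_cons, mul_add]
    exact add_le_add (R.width_pull_le hb) ih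

end Pull

/-! ### All-gather by recursive doubling -/

section Gather

variable {p : ℕ}

/-- The `i`-th round of the cyclic all-gather: `w` receives the units of the nodes at distances
`2 ^ i, …, 2 ^ (i + 1) - 1` from the node at distance `2 ^ i`. -/
def gatherRound (p i : ℕ) : Transfer (Fin p) (Fin p) := fun v w =>
  Finset.univ.filter fun x =>
    (v - w).val = 2 ^ i ∧ 2 ^ i ≤ (x - w).val ∧ (x - w).val < 2 ^ (i + 1)

theorem gatherRound_onePort [NeZero p] (i : ℕ) : (gatherRound p i).OnePort := by
  refine ⟨fun v => ?_, ?_, ?_⟩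
  · ext x
    simp [gatherRound, (pow_pos (two_pos : (0 : ℕ) < 2) i).ne]
  · rintro v w w' ⟨x, hx⟩ ⟨x', hx'⟩
    simp only [gatherRound, Finset.mem_filter] at hx hx'
    exact sub_right_injective (b := v) (Fin.ext (hx.2.1.trans hx'.2.1.symm))
  · rintro v v' w ⟨x, hx⟩ ⟨x', hx'⟩
    simp only [gatherRound, Finset.mem_filter] at hx hx'
    exact sub_left_injective (b := w) (Fin.ext (hx.2.1.trans hx'.2.1.symm))

theorem width_gatherRound_le [NeZero p] (i : ℕ) :
    (gatherRound p i).width + min (2 ^ i) p ≤ min (2 ^ (i + 1)) p := by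
  have hle : min (2 ^ i) p ≤ min (2 ^ (i + 1)) p :=
    min_le_min_right p (Nat.pow_le_pow_right two_pos i.le_succ)
  suffices h : (gatherRound p i).width ≤ min (2 ^ (i + 1)) p - min (2 ^ i) p by omega
  refine Transfer.width_le fun v w => ?_
  rw [← Nat.card_Ico]
  refine Finset.card_le_card_of_injOn (fun x => (x - w).val) (fun x hx => ?_)
    fun x _ y _ hxy => sub_left_injective (b := w) (Fin.ext hxy)
  simp only [gatherRound, Finset.coe_filter, Set.mem_ofPred_eq] at hx
  have := (x - w).isLt
  simp only [Finset.coe_Ico, Set.mem_Ico]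
  omega

/-- `i` rounds of the cyclic all-gather. -/
def gather (p i : ℕ) : List (Transfer (Fin p) (Fin p)) := (List.range i).map (gatherRound p)

theorem gather_succ (p i : ℕ) : gather p (i + 1) = gather p i ++ [gatherRound p i] := by
  simp [gather, List.range_succ]

theorem sum_width_gather_le [NeZero p] (i : ℕ) :
    ((gather p i).map Transfer.width).sum + 1 ≤ min (2 ^ i) p := by
  induction i with
  | zero => simpa [gather] using Nat.one_le_iff_ne_zero.2 (NeZero.ne p)
  | succ i ih =>
    have := width_gatherRound_le (p := p) i
    simp only [gather_succ, List.map_append, List.sum_append, List.map_cons, List.map_nil,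
      List.sum_singleton]
    omega

/-- After `i` rounds every node holds the units of the nodes at distance less than `2 ^ i`. -/
theorem feasible_gather [NeZero p] (i : ℕ) :
    Feasible (fun v => {v}) (gather p i) ∧
      ∀ w x : Fin p, (x - w).val < 2 ^ i → x ∈ held (fun v => {v}) (gather p i) w := by
  induction i with
  | zero =>
    refine ⟨trivial, fun w x hx => ?_⟩
    have h0 : x - w = 0 := Fin.ext (by simpa using hx)
    exact sub_eq_zero.1 h0
  | succ i ih =>
    have hdist : ∀ v w x : Fin p, (v - w).val = 2 ^ i → 2 ^ i ≤ (x - w).val →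
        (x - v).val = (x - w).val - 2 ^ i := fun v w x hv hx => by
      rw [← sub_sub_sub_cancel_right x v w, Fin.sub_val_of_le (Fin.le_def.2 (hv ▸ hx)), hv]
    rw [gather_succ, feasible_append, held_append]
    refine ⟨⟨ih.1, gatherRound_onePort i, fun v w x hx => ?_, trivial⟩, fun w x hx => ?_⟩
    · simp only [gatherRound, Finset.mem_filter] at hx
      refine ih.2 v x ?_
      rw [hdist v w x hx.2.1 hx.2.2.1]
      have := pow_succ 2 i
      omega
    · rcases lt_or_ge (x - w).val (2 ^ i) with h | h
      · exact Or.inl (ih.2 w x h)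
      · refine Or.inr ⟨w + ⟨2 ^ i, h.trans_lt (x - w).isLt⟩, ?_⟩
        simpa [gatherRound, h] using hx

end Gather

/-! ### Scatter along a binomial tree -/

section Scatter

variable {s : ℕ}

/-- The round of the scatter with stride `2 ^ e`: the unit `x`, which has reached the largest
multiple of `2 ^ (e + 1)` up to `x`, moves on to the largest multiple of `2 ^ e` up to `x`. -/
def scatterRound (s e : ℕ) : Transfer (Fin (s + 1)) (Fin (s + 1)) := fun v w =>
  Finset.univ.filter fun x =>
    v.val = x.val / 2 ^ (e + 1) * 2 ^ (e + 1) ∧ w.val = x.val / 2 ^ e * 2 ^ e ∧ v ≠ w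

theorem mem_scatterRound {e : ℕ} {v w x : Fin (s + 1)} (h : x ∈ scatterRound s e v w) :
    2 ^ (e + 1) ∣ v.val ∧ w.val = v.val + 2 ^ e ∧ w.val ≤ x.val ∧ x.val < w.val + 2 ^ e := by
  simp only [scatterRound, Finset.mem_filter, Finset.mem_univ, true_and, ne_eq, Fin.ext_iff] at h
  obtain ⟨hv, hw, hne⟩ := h
  refine ⟨⟨_, hv.trans (mul_comm _ _)⟩, ?_⟩
  have hpos : 0 < 2 ^ e := by positivity
  rw [pow_succ, ← Nat.div_div_eq_div_mul] at hv
  have h1 := Nat.div_add_mod x.val (2 ^ e)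
  have h2 := Nat.mod_lt x.val hpos
  set a := x.val / 2 ^ e
  rw [mul_comm] at h1
  rcases Nat.even_or_odd' a with ⟨b, hb | hb⟩
  · have : a / 2 = b := by omega
    exact absurd (by rw [hv, hw, this, hb]; ring) hne
  · have : a / 2 = b := by omega
    have hv' : v.val = 2 * b * 2 ^ e := by rw [hv, this]; ring
    have hw' : w.val = 2 * b * 2 ^ e + 2 ^ e := by rw [hw, hb]; ring
    omega

theorem scatterRound_onePort (e : ℕ) : (scatterRound s e).OnePort := by
  refine ⟨fun v => ?_, ?_, ?_⟩
  · ext x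
    simp [scatterRound]
  · rintro v w w' ⟨x, hx⟩ ⟨x', hx'⟩
    have h := (mem_scatterRound hx).2.1
    have h' := (mem_scatterRound hx').2.1
    exact Fin.ext (by omega)
  · rintro v v' w ⟨x, hx⟩ ⟨x', hx'⟩
    have h := (mem_scatterRound hx).2.1
    have h' := (mem_scatterRound hx').2.1
    exact Fin.ext (by omega)

theorem width_scatterRound_le (e : ℕ) :
    (scatterRound s e).width + min (2 ^ e) (s + 1) ≤ min (2 ^ (e + 1)) (s + 1) := by
  have hle : min (2 ^ e) (s + 1) ≤ min (2 ^ (e + 1)) (s + 1) :=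
    min_le_min_right _ (Nat.pow_le_pow_right two_pos e.le_succ)
  suffices h : (scatterRound s e).width ≤ min (2 ^ (e + 1)) (s + 1) - min (2 ^ e) (s + 1) by
    omega
  refine Transfer.width_le fun v w => ?_
  rcases (scatterRound s e v w).eq_empty_or_nonempty with h0 | ⟨y, hy⟩
  · simp [h0]
  have hy' := mem_scatterRound hy
  have hsub : (scatterRound s e v w).card ≤ (Finset.Ico w.val (min (w.val + 2 ^ e) (s + 1))).card :=
    Finset.card_le_card_of_injOn Fin.val (fun x hx => by
      have := mem_scatterRound hx
      have := x.isLt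
      simp only [Finset.coe_Ico, Set.mem_Ico]
      omega) Fin.val_injective.injOn
  refine hsub.trans ?_
  rw [Nat.card_Ico]
  have hp := pow_succ 2 e
  have := w.isLt
  rcases Nat.eq_zero_or_pos v.val with h | h
  · omega
  -- A sender other than the root sits at `2 ^ (e + 1)` or later, so both minima are powers of two.
  · have := Nat.le_of_dvd h hy'.1
    omega

/-- The scatter with the strides `2 ^ (e - 1), …, 2, 1`. -/
def scatter (s : ℕ) : ℕ → List (Transfer (Fin (s + 1)) (Fin (s + 1)))
  | 0 => []
  | e + 1 => scatterRound s e :: scatter s e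

theorem length_scatter (e : ℕ) : (scatter s e).length = e := by
  induction e with
  | zero => rfl
  | succ e ih => simp [scatter, ih]

theorem sum_width_scatter_le (e : ℕ) :
    ((scatter s e).map Transfer.width).sum + 1 ≤ min (2 ^ e) (s + 1) := by
  induction e with
  | zero => simp [scatter]
  | succ e ih =>
    have := width_scatterRound_le (s := s) e
    simp only [scatter, List.map_cons, List.sum_cons]
    omega

theorem feasible_scatter (e : ℕ) (H : Fin (s + 1) → Set (Fin (s + 1)))
    (hH : ∀ v x : Fin (s + 1), v.val = x.val / 2 ^ e * 2 ^ e → x ∈ H v) :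
    Feasible H (scatter s e) ∧ ∀ v, v ∈ held H (scatter s e) v := by
  induction e generalizing H with
  | zero => exact ⟨trivial, fun v => hH v v (by simp)⟩
  | succ e ih =>
    have key := ih (hold H (scatterRound s e)) fun w x hw => by
      have hlt : x.val / 2 ^ (e + 1) * 2 ^ (e + 1) < s + 1 :=
        (Nat.div_mul_le_self _ _).trans_lt x.isLt
      by_cases hv : (⟨_, hlt⟩ : Fin (s + 1)) = w
      · exact Or.inl (hH w x (by rw [← hv]))
      · exact Or.inr ⟨⟨_, hlt⟩, by simp [scatterRound, hw, Fin.ext_iff] at hv ⊢; exact hv⟩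
    refine ⟨⟨scatterRound_onePort e, fun v w x hx => hH v x ?_, key.1⟩, key.2⟩
    simp only [scatterRound, Finset.mem_filter] at hx
    exact hx.2.1

end Scatter

/-! ### Broadcast from several sources -/

/-- Each of the `r` sources scatters its `s` units over `s` destination nodes of its own, and then
all destination nodes perform an all-gather. Some nodes may be left out in the scatter. -/
theorem exists_spread (p r s : ℕ) (hp : 0 < p) (hs : 0 < s) (hrs : r * s ≤ p) :
    ∃ Rs : List (Transfer (Fin p ⊕ Fin r) (Fin r × Fin s)),
      Feasible (origin fun u => Sum.inr u.1) Rs ∧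
      (∀ i u, u ∈ held (origin fun u => Sum.inr u.1) Rs (Sum.inl i)) ∧
      Rs.length = Nat.clog 2 (s + 1) + Nat.clog 2 p ∧
      (Rs.map Transfer.width).sum ≤ s + (p - 1) := by
  have : NeZero p := ⟨hp.ne'⟩
  have hlt : ∀ u : Fin r × Fin s, u.1.val * s + u.2.val < p := fun u => by
    have := Nat.mul_le_mul_right s (Nat.succ_le_of_lt u.1.isLt)
    have := u.2.isLt
    rw [Nat.succ_mul] at *
    omega
  have hdiv : ∀ u : Fin r × Fin s, (u.1.val * s + u.2.val) / s = u.1.val := fun u => by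
    rw [mul_comm, Nat.mul_add_div hs, Nat.div_eq_of_lt u.2.isLt, add_zero]
  have hmod : ∀ u : Fin r × Fin s, (u.1.val * s + u.2.val) % s = u.2.val := fun u => by
    rw [mul_comm, Nat.mul_add_mod, Nat.mod_eq_of_lt u.2.isLt]
  -- In the scatter, `Sum.inl i` is child number `i % s` of the source `i / s`, if this is one.
  let grp : Fin p ⊕ Fin r → ℕ := Sum.elim (fun i => i.val / s) fun j => j.val
  let pos : Fin p ⊕ Fin r → Fin (s + 1) :=
    Sum.elim (fun i => ⟨i.val % s + 1, Nat.succ_lt_succ (Nat.mod_lt _ hs)⟩) fun _ => 0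
  let cls : Fin r × Fin s → ℕ := fun u => u.1.val
  let lab : Fin r × Fin s → Fin (s + 1) := fun u => u.2.succ
  let own : Fin r × Fin s → Fin p := fun u => ⟨_, hlt u⟩
  have hc : IsCopy grp pos cls := by
    constructor
    · rintro (i | j) (i' | j') u h h' hpos
      · have h1 : i.val / s = i'.val / s := h.trans h'.symm
        have h2 : i.val % s = i'.val % s := Nat.succ.inj (congrArg Fin.val hpos)
        have : i.val = i'.val := by rw [← Nat.div_add_mod i.val s, h1, h2, Nat.div_add_mod]
        rw [Fin.ext this]
      · exact absurd (congrArg Fin.val hpos) (Nat.succ_ne_zero _)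
      · exact absurd (congrArg Fin.val hpos).symm (Nat.succ_ne_zero _)
      · exact congrArg Sum.inr (Fin.ext (h.trans h'.symm))
    · intro x u
      induction x using Fin.cases with
      | zero => exact ⟨Sum.inr u.1, rfl, rfl⟩
      | succ c =>
        exact ⟨Sum.inl (own (u.1, c)), hdiv (u.1, c),
          Fin.ext (congrArg Nat.succ (hmod (u.1, c)))⟩
  -- In the all-gather, the unit `u` belongs to `Sum.inl (own u)`, which the scatter brought it to;
  -- the sources take no part.
  let pos' : Fin p ⊕ Fin r → Fin p := Sum.elim id fun _ => 0
  have hc' : IsCopy (Sum.isLeft : Fin p ⊕ Fin r → Bool) pos'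
      (fun _ : Fin r × Fin s => true) := by
    constructor
    · rintro (i | j) (i' | j') u h h' hpos
      · exact congrArg Sum.inl hpos
      all_goals simp at h h'
    · exact fun x u => ⟨Sum.inl x, rfl, rfl⟩
  set e := Nat.clog 2 (s + 1)
  -- All units start at the root `0`, since `x / 2 ^ e = 0` for every position `x`.
  have hsc := feasible_scatter (s := s) e (fun v => {_x | v = 0}) fun v x hv => by
    have hx : x.val < 2 ^ e := x.isLt.trans_le (Nat.le_pow_clog one_lt_two _)
    rw [Nat.div_eq_of_lt hx, zero_mul] at hv
    exact Fin.ext hv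
  have h0 : ∀ v u, grp v = cls u → lab u ∈ ({_x | pos v = 0} : Set (Fin (s + 1))) →
      u ∈ origin (fun u : Fin r × Fin s => (Sum.inr u.1 : Fin p ⊕ Fin r)) v := by
    rintro (i | j) u h h'
    · exact absurd (congrArg Fin.val (show pos (Sum.inl i) = 0 from h'))
        (Nat.succ_ne_zero _)
    · exact congrArg Sum.inr (Fin.ext h)
  have hF := hsc.1.pull (lab := lab) hc h0
  set Ss := (scatter s e).map (Transfer.pull grp pos cls lab)
  have h1 : ∀ v u, Sum.isLeft v = true → own u ∈ ({pos' v} : Set (Fin p)) →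
      u ∈ held (origin fun u => Sum.inr u.1) Ss v := by
    rintro (i | j) u h h'
    · obtain rfl : own u = i := h'
      refine held_pull (H := fun v => {_x | v = 0}) (lab := lab) hc h0 (Sum.inl (own u)) u
        (hdiv u) ?_
      have : pos (Sum.inl (own u)) = lab u := Fin.ext (congrArg Nat.succ (hmod u))
      rw [this]
      exact hsc.2 _
    · simp at h
  have hga := feasible_gather (p := p) (Nat.clog 2 p)
  have hF' := hga.1.pull (lab := own) hc' h1
  have hle := Nat.le_pow_clog one_lt_two p
  refine ⟨Ss ++ (gather p (Nat.clog 2 p)).map (Transfer.pull Sum.isLeft pos' (fun _ => true) own),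
    feasible_append.2 ⟨hF, hF'⟩, fun i u => ?_, ?_, ?_⟩
  · rw [held_append]
    exact held_pull hc' h1 _ u rfl (hga.2 _ _ ((Fin.isLt _).trans_le hle))
  · simp [Ss, gather, length_scatter]
  · rw [List.map_append, List.sum_append]
    have hs1 := sum_width_scatter_le (s := s) e
    have hs2 := sum_width_gather_le (p := p) (Nat.clog 2 p)
    have hb1 : (Ss.map Transfer.width).sum ≤ 1 * _ :=
      sum_width_pull_le (scatter s e) fun j x => Finset.card_le_one.2 fun u hu u' hu' => by
        simp only [Finset.mem_filter] at hu hu'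
        exact Prod.ext (Fin.ext (hu.2.1.trans hu'.2.1.symm))
          (Fin.succ_injective _ (hu.2.2.trans hu'.2.2.symm))
    have hb2 := sum_width_pull_le (grp := (Sum.isLeft : Fin p ⊕ Fin r → Bool)) (pos := pos')
      (cls := fun _ => true) (lab := own) (b := 1) (gather p (Nat.clog 2 p))
      fun j x => Finset.card_le_one.2 fun u hu u' hu' => by
        simp only [Finset.mem_filter] at hu hu'
        have h : u.1.val * s + u.2.val = u'.1.val * s + u'.2.val :=
          congrArg Fin.val (hu.2.2.trans hu'.2.2.symm)
        exact Prod.ext (Fin.ext (by rw [← hdiv u, h, hdiv u']))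
          (Fin.ext (by rw [← hmod u, h, hmod u']))
    have := min_le_right (2 ^ e) (s + 1)
    have := min_le_right (2 ^ Nat.clog 2 p) p
    omega

/-! ### Schemes, their concatenation and their cost -/

section Schemes

variable {V F X Y : Type*} [Field F] [AddCommGroup X] [Module F X] [AddCommGroup Y] [Module F Y]

theorem final_append (W : Knowledge V F X) (S T : Scheme V F X) :
    final W (S ++ T) = final (final W S) T := List.foldl_append

theorem valid_append {W : Knowledge V F X} {S T : Scheme V F X} :
    Valid W (S ++ T) ↔ Valid W S ∧ Valid (final W S) T := by
  induction S generalizing W with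
  | nil => simp [Valid, final]
  | cons R S ih => simp [Valid, final, ih, and_assoc]

theorem mem_learn_of_mem {W : Knowledge V F X} {R : Round V F X} {v w : V}
    {f : Module.Dual F X} (h : f ∈ R v w) : f ∈ learn W R w :=
  Submodule.mem_sup_right (Submodule.mem_iSup_of_mem v (Submodule.subset_span h))

theorem le_learn (W : Knowledge V F X) (R : Round V F X) (w : V) : W w ≤ learn W R w :=
  le_sup_left

theorem le_final (W : Knowledge V F X) (S : Scheme V F X) (v : V) : W v ≤ final W S v := by
  induction S generalizing W with
  | nil => exact le_rfl
  | cons R S ih => exact (le_learn W R v).trans (ih _)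

theorem learn_onData_le (φ : X →ₗ[F] Y) {W : Knowledge V F Y} {W' : Knowledge V F X}
    (h : ∀ v, ∀ f ∈ W v, f ∘ₗ φ ∈ W' v) (R : Round V F Y) (v : V) :
    ∀ f ∈ learn W R v, f ∘ₗ φ ∈ learn W' (fun v w => (R v w).map fun f => f ∘ₗ φ) v := by
  set R' : Round V F X := fun v w => (R v w).map fun f => f ∘ₗ φ
  have hmem : ∀ f : Module.Dual F Y, ∀ K : Submodule F (Module.Dual F X),
      f ∈ K.comap φ.dualMap ↔ f ∘ₗ φ ∈ K := fun f K => Iff.rfl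
  suffices hle : learn W R v ≤ (learn W' R' v).comap φ.dualMap from
    fun f hf => (hmem f _).1 (hle hf)
  refine sup_le (fun f hf => (hmem f _).2 (le_learn W' R' v (h v f hf)))
    (iSup_le fun w => Submodule.span_le.2 fun f hf => (hmem f _).2 ?_)
  exact mem_learn_of_mem (v := w) (List.mem_map.2 ⟨f, hf, rfl⟩)

theorem final_onData (φ : X →ₗ[F] Y) {W : Knowledge V F Y} {W' : Knowledge V F X}
    (h : ∀ v, ∀ f ∈ W v, f ∘ₗ φ ∈ W' v) (S : Scheme V F Y) (v : V) :
    ∀ f ∈ final W S v, f ∘ₗ φ ∈ final W' (onData φ S) v := by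
  induction S generalizing W W' with
  | nil => exact h v
  | cons R S ih => exact ih (learn_onData_le φ h R)

theorem valid_onData (φ : X →ₗ[F] Y) {W : Knowledge V F Y} {W' : Knowledge V F X}
    (h : ∀ v, ∀ f ∈ W v, f ∘ₗ φ ∈ W' v) {S : Scheme V F Y} (hS : Valid W S) :
    Valid W' (onData φ S) := by
  induction S generalizing W W' with
  | nil => trivial
  | cons R S ih =>
    obtain ⟨⟨h1, h2, h3⟩, hv, hS⟩ := hS
    refine ⟨⟨fun v => by simp [h1], fun v w w' => ?_, fun v v' w => ?_⟩, fun v w f hf => ?_,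
      ih (learn_onData_le φ h R) hS⟩
    · simpa using h2 v w w'
    · simpa using h3 v v' w
    · obtain ⟨g, hg, rfl⟩ := List.mem_map.1 hf
      exact h v g (hv v w g hg)

theorem loads_append (S T : Scheme V F X) : loads (S ++ T) = loads S ++ loads T :=
  List.map_append

theorem loads_onData (φ : X →ₗ[F] Y) (S : Scheme V F Y) : loads (onData φ S) = loads S := by
  simp only [loads, onData, List.map_map]
  refine List.map_congr_left fun R _ => ?_
  ext v w
  simp [load]

/-- The data of a scheme that its cost depends on: the number of rounds, and the sum of the largest
numbers of units over the rounds. -/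
theorem cost_eq [Fintype V] (α β : ℝ) (q : ℕ) (S : Scheme V F X) :
    cost α β q S = (loads S).length * α + (((loads S).map maxLoad).sum : ℕ) / q * β := by
  unfold cost
  induction loads S with
  | nil => simp
  | cons b L ih =>
    simp only [List.map_cons, List.sum_cons, ih, List.length_cons]
    push_cast
    ring

theorem cost_le [Fintype V] {α β : ℝ} (hα : 0 ≤ α) (hβ : 0 ≤ β) {q : ℕ} (hq : 0 < q)
    {S : Scheme V F X} {c r n : ℕ} (hc : (loads S).length ≤ 2 * c)
    (hn : ((loads S).map maxLoad).sum ≤ 2 * (r * (n * q))) :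
    cost α β q S ≤ 2 * ((c : ℝ) * α + (r : ℝ) * n * β) := by
  have hq' : (0 : ℝ) < q := by exact_mod_cast hq
  have hc' : ((loads S).length : ℝ) ≤ 2 * c := by exact_mod_cast hc
  have hn' : ((((loads S).map maxLoad).sum : ℕ) : ℝ) ≤ 2 * (r * (n * q)) := by exact_mod_cast hn
  rw [cost_eq]
  calc _ ≤ 2 * (c : ℝ) * α + (2 * (r * n) : ℝ) * β :=
        add_le_add (mul_le_mul_of_nonneg_right hc' hα)
          (mul_le_mul_of_nonneg_right ((div_le_iff₀ hq').2 (by linarith)) hβ)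
    _ = _ := by ring

theorem maxLoad_swap [Fintype V] (b : V → V → ℕ) : (maxLoad fun v w => b w v) = maxLoad b :=
  Finset.sup_comm _ _ _

theorem sum_maxLoad_reverseLoads [Fintype V] (L : List (V → V → ℕ)) :
    ((reverseLoads L).map maxLoad).sum = (L.map maxLoad).sum := by
  simp [reverseLoads, Function.comp_def, maxLoad_swap]

end Schemes

/-! ### Forwarding schemes -/

section Forward

variable {V U F X : Type*} [Field F] [AddCommGroup X] [Module F X]

/-- The loads of a routing schedule. -/
def routeLoads (Rs : List (Transfer V U)) : List (V → V → ℕ) :=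
  Rs.map fun R v w => (R v w).card

theorem sum_maxLoad_routeLoads [Fintype V] (Rs : List (Transfer V U)) :
    ((routeLoads Rs).map maxLoad).sum = (Rs.map Transfer.width).sum := by
  rw [routeLoads, List.map_map]
  rfl

/-- The round in which each label `u` in `R v w` stands for the unit `f v u`. -/
noncomputable def sendUnits (f : V → U → Module.Dual F X) (R : Transfer V U) : Round V F X :=
  fun v w => (R v w).toList.map (f v)

theorem mem_sendUnits {f : V → U → Module.Dual F X} {R : Transfer V U} {v w : V}
    {g : Module.Dual F X} : g ∈ sendUnits f R v w ↔ ∃ u ∈ R v w, f v u = g := by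
  simp [sendUnits]

theorem sendUnits_ne_nil {f : V → U → Module.Dual F X} {R : Transfer V U} {v w : V} :
    sendUnits f R v w ≠ [] ↔ (R v w).Nonempty := by
  simp [sendUnits, Finset.nonempty_iff_ne_empty]

theorem load_sendUnits (f : V → U → Module.Dual F X) (R : Transfer V U) :
    load (sendUnits f R) = fun v w => (R v w).card := by
  ext v w
  simp [load, sendUnits]

theorem Transfer.OnePort.sendUnits {R : Transfer V U} (hR : R.OnePort)
    (f : V → U → Module.Dual F X) : CommScheme.OnePort (sendUnits f R) := by
  refine ⟨fun v => by simp [CommScheme.sendUnits, hR.1], fun v w w' h h' => ?_,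
    fun v v' w h h' => ?_⟩
  · exact hR.2.1 v w w' (sendUnits_ne_nil.1 h) (sendUnits_ne_nil.1 h')
  · exact hR.2.2 v v' w (sendUnits_ne_nil.1 h) (sendUnits_ne_nil.1 h')

/-- The scheme that forwards units without combining them. -/
noncomputable def forward (f : U → Module.Dual F X) (Rs : List (Transfer V U)) : Scheme V F X :=
  Rs.map (sendUnits fun _ => f)

theorem loads_forward (f : U → Module.Dual F X) (Rs : List (Transfer V U)) :
    loads (forward f Rs) = routeLoads Rs := by
  simp [loads, forward, routeLoads, Function.comp_def, load_sendUnits]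

theorem learn_forward {f : U → Module.Dual F X} {H : V → Set U} {W : Knowledge V F X}
    (h : ∀ v, ∀ u ∈ H v, f u ∈ W v) (R : Transfer V U) (v : V) :
    ∀ u ∈ hold H R v, f u ∈ learn W (sendUnits (fun _ => f) R) v := by
  rintro u (hu | ⟨x, hx⟩)
  · exact le_learn _ _ _ (h v u hu)
  · exact mem_learn_of_mem (mem_sendUnits.2 ⟨u, hx, rfl⟩)

theorem final_forward {f : U → Module.Dual F X} {H : V → Set U} {W : Knowledge V F X}
    (h : ∀ v, ∀ u ∈ H v, f u ∈ W v) (Rs : List (Transfer V U)) (v : V) :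
    ∀ u ∈ held H Rs v, f u ∈ final W (forward f Rs) v := by
  induction Rs generalizing H W with
  | nil => exact h v
  | cons R Rs ih => exact ih (learn_forward h R)

theorem valid_forward {f : U → Module.Dual F X} {H : V → Set U} {W : Knowledge V F X}
    (h : ∀ v, ∀ u ∈ H v, f u ∈ W v) {Rs : List (Transfer V U)} (hF : Feasible H Rs) :
    Valid W (forward f Rs) := by
  induction Rs generalizing H W with
  | nil => trivial
  | cons R Rs ih =>
    refine ⟨hF.1.sendUnits _, fun v w g hg => ?_, ih (learn_forward h R) hF.2.2⟩
    obtain ⟨u, hu, rfl⟩ := mem_sendUnits.1 hg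
    exact h v u (hF.2.1 v w u hu)

theorem within_sendUnits {rel : V → V → Prop} {Rs : List (Transfer V U)}
    (h : ∀ R ∈ Rs, ∀ v w, (R v w).Nonempty → rel v w) (f : U → Module.Dual F X) :
    Within rel (forward f Rs) := by
  intro R hR v w hne
  obtain ⟨R', hR', rfl⟩ := List.mem_map.1 hR
  exact h R' hR' v w (sendUnits_ne_nil.1 hne)

end Forward

/-! ### Reversing a broadcast yields a reduction -/

section Reverse

variable {V U F X : Type*} [Field F] [AddCommGroup X] [Module F X]

/-- The transposed round: all transmissions go in the opposite direction. -/
def Transfer.flip (R : Transfer V U) : Transfer V U := fun v w => R w v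

theorem Transfer.OnePort.flip {R : Transfer V U} (hR : R.OnePort) : R.flip.OnePort :=
  ⟨hR.1, fun v w w' => hR.2.2 w w' v, fun v v' w => hR.2.1 w v v'⟩

variable [Fintype V]

open Classical in
/-- The partial sums after the transposed round: a node that passed its partial sum on continues
with zero, and the partial sums that arrive are added. -/
noncomputable def passOn (R : Transfer V U) (acc : V → U → Module.Dual F X) :
    V → U → Module.Dual F X :=
  fun v u => (if ∃ x, u ∈ R x v then 0 else acc v u) + ∑ w, if u ∈ R v w then acc w u else 0

/-- Each node receives from at most one node, so that it passes its partial sum on to at most one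
node in the transposed round: nothing gets lost, and nothing is counted twice. -/
theorem sum_passOn {R : Transfer V U} (hR : R.OnePort) (acc : V → U → Module.Dual F X) (u : U) :
    ∑ v, passOn R acc v u = ∑ v, acc v u := by
  classical
  unfold passOn
  rw [Finset.sum_add_distrib, Finset.sum_comm, ← Finset.sum_add_distrib]
  refine Finset.sum_congr rfl fun w _ => ?_
  by_cases h : ∃ x, u ∈ R x w
  · obtain ⟨x, hx⟩ := h
    rw [if_pos ⟨x, hx⟩, zero_add, Finset.sum_eq_single x, if_pos hx]
    · intro y _ hy
      exact if_neg fun hy' => hy (hR.2.2 y x w ⟨u, hy'⟩ ⟨u, hx⟩)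
    · simp
  · rw [if_neg h, Finset.sum_eq_zero, add_zero]
    exact fun x _ => if_neg fun hx => h ⟨x, hx⟩

/-- If the nodes with a nonzero partial sum held the unit after a round of the schedule, then after
the transposed round they are among the nodes that held it before: a node that received the unit
has been reset to zero, and partial sums arrive at its senders only. -/
theorem mem_of_passOn_ne_zero {H : V → Set U} {R : Transfer V U}
    (hs : ∀ v w, ∀ u ∈ R v w, u ∈ H v) {acc : V → U → Module.Dual F X}
    (hacc : ∀ v u, acc v u ≠ 0 → u ∈ hold H R v) (v : V) (u : U) (h : passOn R acc v u ≠ 0) :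
    u ∈ H v := by
  classical
  by_contra hv
  refine h ?_
  unfold passOn
  rw [Finset.sum_eq_zero fun w _ => if_neg fun hw => hv (hs v w u hw), add_zero]
  split_ifs with hx
  · rfl
  · by_contra h0
    exact (hacc v u h0).elim hv hx

/-- The scheme that transposes the rounds of the list one by one, with partial sums in place of
the units. -/
noncomputable def collect : List (Transfer V U) → (V → U → Module.Dual F X) → Scheme V F X
  | [], _ => []
  | R :: Rs, acc => sendUnits acc R.flip :: collect Rs (passOn R acc)

theorem loads_collect_reverse (Rs : List (Transfer V U)) (acc : V → U → Module.Dual F X) :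
    loads (collect Rs.reverse acc) = reverseLoads (routeLoads Rs) := by
  have : ∀ Ts : List (Transfer V U), ∀ acc : V → U → Module.Dual F X,
      loads (collect Ts acc) = Ts.map fun R v w => (R w v).card := fun Ts => by
    induction Ts with
    | nil => exact fun _ => rfl
    | cons R Ts ih =>
      intro acc
      rw [collect, loads, List.map_cons, load_sendUnits, ← loads, ih]
      rfl
  rw [this, reverseLoads, routeLoads, List.map_map, List.map_reverse]
  rfl

theorem within_collect {rel : V → V → Prop} {Rs : List (Transfer V U)}
    (h : ∀ R ∈ Rs, ∀ v w, (R v w).Nonempty → rel w v) (acc : V → U → Module.Dual F X) :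
    Within rel (collect Rs acc) := by
  induction Rs generalizing acc with
  | nil => simp [collect, Within]
  | cons R Rs ih =>
    intro R' hR'
    rcases List.mem_cons.1 hR' with rfl | hR'
    · exact fun v w hne => h R List.mem_cons_self w v (sendUnits_ne_nil (R := R.flip).1 hne)
    · exact ih (fun T hT => h T (List.mem_cons_of_mem _ hT)) _ R' hR'

/-- If a schedule spreads every unit from one node to all nodes that hold a summand, then its
transpose collects the sum of the summands at this node. -/
theorem performs_collect_reverse {Rs : List (Transfer V U)} {src : U → V}
    (hF : Feasible (origin src) Rs) {acc : V → U → Module.Dual F X} {W : Knowledge V F X}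
    (hW : ∀ v u, acc v u ∈ W v) (hacc : ∀ v u, acc v u ≠ 0 → u ∈ held (origin src) Rs v) :
    Valid W (collect Rs.reverse acc) ∧
      ∀ u, ∑ v, acc v u ∈ final W (collect Rs.reverse acc) (src u) := by
  induction Rs using List.reverseRecOn generalizing acc W with
  | nil =>
    refine ⟨trivial, fun u => ?_⟩
    rw [Finset.sum_eq_single (src u) (fun v _ hv => ?_) (by simp)]
    · exact hW _ u
    · exact by_contra fun h => hv (hacc v u h)
  | append_singleton Rs R ih =>
    obtain ⟨hF, hR, hs, -⟩ := feasible_append.1 hF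
    rw [held_append] at hacc
    have key := ih (acc := passOn R acc) (W := learn W (sendUnits acc R.flip)) hF
      (fun v u => ?_) (mem_of_passOn_ne_zero hs hacc)
    · rw [List.reverse_append, List.reverse_singleton, List.singleton_append]
      refine ⟨⟨hR.flip.sendUnits acc, fun v w g hg => ?_, key.1⟩, fun u => ?_⟩
      · obtain ⟨u, -, rfl⟩ := mem_sendUnits.1 hg
        exact hW v u
      · rw [← sum_passOn hR]
        exact key.2 u
    · refine Submodule.add_mem _ ?_ (Submodule.sum_mem _ fun w _ => ?_)
      · split_ifs
        · exact Submodule.zero_mem _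
        · exact le_learn _ _ _ (hW v u)
      · split_ifs with h
        · exact mem_learn_of_mem (v := w) (mem_sendUnits.2 ⟨u, h, rfl⟩)
        · exact Submodule.zero_mem _

end Reverse

/-! ### Multi-reduce and multi-broadcast -/

section Parallel

/-- Broadcasts from `r` sources to `p` nodes, run in parallel in several copies. A block of a
source consists of `s` pieces, each of which stands for at most `b` units. -/
theorem exists_parallel_spread {V' U' J : Type*} [Fintype V'] [Fintype U'] [DecidableEq J]
    {p r s b : ℕ} (hp : 0 < p) (hs : 0 < s) (hrs : r * s ≤ p)
    {grp : V' → J} {pos : V' → Fin p ⊕ Fin r} {cls : U' → J} {lab : U' → Fin r × Fin s}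
    (hc : IsCopy grp pos cls)
    (hb : ∀ j x, (Finset.univ.filter fun u => cls u = j ∧ lab u = x).card ≤ b)
    {src : U' → V'} (hsrc : ∀ u, grp (src u) = cls u ∧ pos (src u) = Sum.inr (lab u).1) :
    ∃ Rs : List (Transfer V' U'),
      Feasible (origin src) Rs ∧
      (∀ v u i, grp v = cls u → pos v = Sum.inl i → u ∈ held (origin src) Rs v) ∧
      (∀ R ∈ Rs, ∀ v w, (R v w).Nonempty → grp v = grp w) ∧
      Rs.length = Nat.clog 2 (s + 1) + Nat.clog 2 p ∧
      (Rs.map Transfer.width).sum ≤ b * (s + (p - 1)) := by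
  obtain ⟨Rs, hF, hheld, hlen, hwid⟩ := exists_spread p r s hp hs hrs
  have h0 : ∀ v u, grp v = cls u → lab u ∈ origin (fun u => Sum.inr u.1) (pos v) →
      u ∈ origin src v := fun v u hv hu =>
    hc.inj v (src u) u hv (hsrc u).1 (Eq.trans hu (hsrc u).2.symm)
  refine ⟨Rs.map (Transfer.pull grp pos cls lab), hF.pull hc h0, fun v u i hv hi => ?_, ?_,
    by simpa using hlen, (sum_width_pull_le Rs hb).trans (Nat.mul_le_mul_left b hwid)⟩
  · exact held_pull hc h0 v u hv (hi ▸ hheld i _)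
  · intro R hR v w hne
    obtain ⟨R', -, rfl⟩ := List.mem_map.1 hR
    obtain ⟨u, hu⟩ := hne
    have := Transfer.mem_pull.1 hu
    exact this.1.trans this.2.1.symm

/-- Cutting a block of `s * b` units into `s` pieces gives pieces of `b` units. -/
theorem card_filter_divNat_le {t s b : ℕ} (j : Fin t) (c : Fin s) :
    (Finset.univ.filter fun u : Fin t × Fin (s * b) => u.1 = j ∧ u.2.divNat = c).card ≤ b := by
  refine (Finset.card_le_card_of_injOn (t := Finset.univ) (fun u => u.2.modNat)
    (fun _ _ => Finset.mem_coe.2 (Finset.mem_univ _)) fun u hu u' hu' h => ?_).trans_eq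
    (Finset.card_fin b)
  simp only [Finset.coe_filter, Finset.mem_univ, true_and, Set.mem_ofPred_eq] at hu hu'
  refine Prod.ext (hu.1.trans hu'.1.symm) (finProdFinEquiv.symm.injective ?_)
  exact Prod.ext (hu.2.trans hu'.2.symm) h

end Parallel

section Reduce

variable {F : Type*} [Field F]

theorem coord_mem_dataAtLeft {ι κ : Type*} {m : ℕ} (i : ι) (k : Fin m) :
    coord F i k ∈ (dataAtLeft (Sum.inl i : ι ⊕ κ) : Submodule F (Module.Dual F (Data F ι m))) :=
  Submodule.subset_span ⟨k, rfl⟩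

theorem coord_mem_dataAtRight {ι κ : Type*} {m : ℕ} (j : κ) (k : Fin m) :
    coord F j k ∈ (dataAtRight (Sum.inr j : ι ⊕ κ) : Submodule F (Module.Dual F (Data F κ m))) :=
  Submodule.subset_span ⟨k, rfl⟩

/-- The summand that a node contributes to a unit of a reduction. -/
def summand {ι κ : Type*} {m : ℕ} (a : κ → ι → F) (v : ι ⊕ κ) (u : κ × Fin m) :
    Module.Dual F (Data F ι m) :=
  v.elim (fun i => a u.1 i • coord F i u.2) fun _ => 0

/-- The transpose of a schedule that spreads the units of node `Sum.inr j` to all `Sum.inl i` with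
`a j i ≠ 0` is a multi-reduce with coefficients `a`. -/
theorem multiReduce_collect_reverse {ι κ : Type*} [Fintype ι] [Fintype κ] {m : ℕ}
    {Rs : List (Transfer (ι ⊕ κ) (κ × Fin m))} (hF : Feasible (origin fun u => Sum.inr u.1) Rs)
    {a : κ → ι → F}
    (h : ∀ i u, a u.1 i ≠ 0 → u ∈ held (origin fun u => Sum.inr u.1) Rs (Sum.inl i)) :
    MultiReduce a (collect Rs.reverse (summand (m := m) a)) := by
  have key := performs_collect_reverse hF (acc := summand (m := m) a) (W := dataAtLeft)
    (fun v u => ?_) fun v u hne => ?_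
  · refine ⟨key.1, ?_⟩
    rintro (i | j) f hf
    · exact hf.elim
    · obtain ⟨k, rfl⟩ := hf
      have := key.2 (j, k)
      simpa [summand, Fintype.sum_sum_type] using this
  · rcases v with i | j
    · exact Submodule.smul_mem _ _ (coord_mem_dataAtLeft i u.2)
    · exact Submodule.zero_mem _
  · rcases v with i | j
    · exact h i u (left_ne_zero_of_smul hne)
    · exact absurd rfl hne

/-- Each reduction node gets `s = ⌊(p - 1) / r⌋` data nodes of its own in the (transposed)
scatter, and blocks are cut into `s` pieces. Then `p - 1 ≤ r * s + (r - 1) ≤ (2 * r - 1) * s`, so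
that the scatter and the all-gather together move at most `2 * r` blocks. -/
theorem exists_multiReduce {p r : ℕ} (h : r < p) : ∃ d : ℕ, 0 < d ∧
    ∀ (F : Type*) [Field F] (n q : ℕ), 0 < q → d ∣ n * q → ∀ α β : ℝ, 0 ≤ α → 0 ≤ β →
      ∀ a : Fin r → Fin p → F, ∃ S : Scheme (Fin p ⊕ Fin r) F (Data F (Fin p) (n * q)),
        MultiReduce a S ∧
        cost α β q S ≤ 2 * ((Nat.clog 2 p : ℝ) * α + (r : ℝ) * n * β) := by
  rcases Nat.eq_zero_or_pos r with rfl | hr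
  · refine ⟨1, one_pos, fun F _ n q _ _ α β hα hβ a => ⟨[], ⟨trivial, ?_⟩, ?_⟩⟩
    · rintro (i | j) f hf
      · exact hf.elim
      · exact j.elim0
    · simp only [cost, loads, List.map_nil, List.sum_nil]
      positivity
  set s := (p - 1) / r with hs_def
  have hs : 0 < s := Nat.div_pos (by omega) hr
  have hrs : r * s ≤ p := (Nat.mul_div_le _ _).trans (Nat.sub_le _ _)
  refine ⟨s, hs, fun F _ n q hq hd α β hα hβ a => ?_⟩
  obtain ⟨b, hb⟩ := hd
  -- The type of the scheme depends on `n * q`, which is replaced by a variable to rewrite it.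
  suffices H : ∀ m, m = s * b → ∃ S : Scheme (Fin p ⊕ Fin r) F (Data F (Fin p) m),
      MultiReduce a S ∧ (loads S).length ≤ 2 * Nat.clog 2 p ∧
        ((loads S).map maxLoad).sum ≤ 2 * (r * m) by
    obtain ⟨S, hS, h1, h2⟩ := H _ hb
    exact ⟨S, hS, cost_le hα hβ hq h1 h2⟩
  rintro m rfl
  obtain ⟨Rs, hF, hheld, -, hlen, hwid⟩ := exists_parallel_spread (V' := Fin p ⊕ Fin r)
    (U' := Fin r × Fin (s * b)) (J := Unit) (b := b) (h.pos) hs hrs (grp := fun _ => ())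
    (pos := id) (cls := fun _ => ()) (lab := fun u => (u.1, u.2.divNat))
    (src := fun u => Sum.inr u.1) ⟨fun _ _ _ _ _ h => h, fun x _ => ⟨x, rfl, rfl⟩⟩
    (fun _ x => by simpa [Prod.ext_iff] using card_filter_divNat_le (b := b) x.1 x.2)
    fun u => ⟨rfl, rfl⟩
  refine ⟨_, multiReduce_collect_reverse hF fun i u _ => hheld _ u i rfl rfl, ?_, ?_⟩
  · rw [loads_collect_reverse]
    simp only [reverseLoads, routeLoads, List.length_reverse, List.length_map, hlen]
    have hle : s ≤ p - 1 := Nat.div_le_self _ _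
    have := Nat.clog_mono_right 2 (show s + 1 ≤ p by omega)
    omega
  · rw [loads_collect_reverse, sum_maxLoad_reverseLoads, sum_maxLoad_routeLoads]
    have hlt : p - 1 < r * s + r := by
      have := Nat.lt_mul_div_succ (p - 1) hr
      rwa [Nat.mul_succ] at this
    obtain ⟨t, rfl⟩ : ∃ t, r = t + 1 := ⟨r - 1, by omega⟩
    have ht : t ≤ t * s := Nat.le_mul_of_pos_right t hs
    have h1 : (t + 1) * s = t * s + s := Nat.succ_mul t s
    have h2 : s + (p - 1) ≤ 2 * ((t + 1) * s) := by omega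
    calc _ ≤ b * (s + (p - 1)) := hwid
      _ ≤ b * (2 * ((t + 1) * s)) := Nat.mul_le_mul_left b h2
      _ = 2 * ((t + 1) * (s * b)) := by ring

end Reduce

section Groups

variable {F : Type*} [Field F] {r s m : ℕ}

/-- If `S` provides the transformed data `φ x`, then `A` can be run on them after `S`. -/
theorem Performs.append_onData {V X Y : Type*} [AddCommGroup X] [Module F X] [AddCommGroup Y]
    [Module F Y] (φ : X →ₗ[F] Y) {W : Knowledge V F Y} {W' : Knowledge V F X}
    {goal : V → Set (Module.Dual F Y)} {A : Scheme V F Y} {S : Scheme V F X}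
    (hA : Performs W goal A) (hS : Valid W' S) (h : ∀ v, ∀ f ∈ W v, f ∘ₗ φ ∈ final W' S v) :
    Performs W' (fun v => {g | ∃ f ∈ goal v, f ∘ₗ φ = g}) (S ++ onData φ A) := by
  refine ⟨valid_append.2 ⟨hS, valid_onData φ h hA.1⟩, ?_⟩
  rintro v _ ⟨f, hf, rfl⟩
  rw [final_append]
  exact final_onData φ h A v f (hA.2 v f hf)

/-- `dataAtLeft` is spanned by the units of the blocks, so these are all that a preceding scheme
has to provide. -/
theorem forall_mem_dataAtLeft {ι κ X : Type*} [AddCommGroup X] [Module F X]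
    (φ : X →ₗ[F] Data F ι m) {W : Knowledge (ι ⊕ κ) F X}
    (h : ∀ i k, coord F i k ∘ₗ φ ∈ W (Sum.inl i)) :
    ∀ v, ∀ f ∈ dataAtLeft v, f ∘ₗ φ ∈ W v := by
  suffices hle : ∀ v, dataAtLeft v ≤ (W v).comap φ.dualMap from fun v f hf => hle v hf
  rintro (i | j)
  · refine Submodule.span_le.2 ?_
    rintro _ ⟨k, rfl⟩
    exact h i k
  · exact bot_le

/-- A bound for the number of rounds: for `r ≥ 3` it holds because `⌈log₂ (r * s)⌉` is at least
`⌈log₂ r⌉ + ⌈log₂ s⌉ - 1`, and for `r ≤ 2` because there is no loss. -/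
theorem clog_add_two_mul_clog_le {r s : ℕ} (hr : 0 < r) (hs : 2 ≤ s) :
    Nat.clog 2 r + 2 * Nat.clog 2 s ≤ 2 * Nat.clog 2 (r * s) := by
  rcases Nat.lt_or_ge r 3 with h | h
  · interval_cases r
    · simp
    · have h2 : Nat.clog 2 (2 * s) = Nat.clog 2 s + 1 := by
        rw [Nat.clog_of_two_le one_lt_two (by omega)]
        congr 2
        omega
      have h1 : Nat.clog 2 2 = 1 := by simpa using Nat.clog_pow 2 1 one_lt_two
      omega
  · have h1 := Nat.pow_pred_clog_lt_self one_lt_two (show 1 < r by omega)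
    have h2 := Nat.pow_pred_clog_lt_self one_lt_two (show 1 < s by omega)
    have h3 := Nat.le_pow_clog one_lt_two (r * s)
    have h4 : 1 < Nat.clog 2 r := (Nat.lt_clog_iff_pow_lt one_lt_two).2 (by omega)
    have h5 := (Nat.mul_lt_mul'' h1 h2).trans_le h3
    rw [← pow_add] at h5
    have h6 := (Nat.pow_lt_pow_iff_right one_lt_two).1 h5
    simp only [Nat.pred_eq_sub_one] at h6
    omega

theorem exists_allGatherAcross (F : Type*) [Field F] (hr : 0 < r) :
    ∃ A : Scheme ((Fin r × Fin s) ⊕ Fin r) F (Data F (Fin r × Fin s) m),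
      AllGatherAcross A ∧ (loads A).length = Nat.clog 2 r ∧
        ((loads A).map maxLoad).sum ≤ m * (r - 1) := by
  have : NeZero r := ⟨hr.ne'⟩
  -- One copy of the all-gather for each position; `none` is the idle copy of the reduction nodes.
  let grp : (Fin r × Fin s) ⊕ Fin r → Option (Fin s) := Sum.elim (fun i => some i.2) fun _ => none
  let pos : (Fin r × Fin s) ⊕ Fin r → Fin r := Sum.elim Prod.fst id
  let cls : (Fin r × Fin s) × Fin m → Option (Fin s) := fun u => some u.1.2
  let lab : (Fin r × Fin s) × Fin m → Fin r := fun u => u.1.1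
  have hc : IsCopy grp pos cls := by
    constructor
    · rintro (i | j) (i' | j') u h h' hpos
      · exact congrArg Sum.inl (Prod.ext hpos (Option.some_injective _ (h.trans h'.symm)))
      all_goals simp [grp, cls] at h h'
    · exact fun x u => ⟨Sum.inl (x, u.1.2), rfl, rfl⟩
  have h0 : ∀ v u, grp v = cls u → lab u ∈ ({pos v} : Set (Fin r)) →
      u ∈ origin (fun u : (Fin r × Fin s) × Fin m =>
        (Sum.inl u.1 : (Fin r × Fin s) ⊕ Fin r)) v :=
    fun v u hv hu => hc.inj v (Sum.inl u.1) u hv rfl (Eq.symm hu)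
  have hga := feasible_gather (p := r) (Nat.clog 2 r)
  have hW : ∀ v, ∀ u ∈ origin (fun u : (Fin r × Fin s) × Fin m =>
      (Sum.inl u.1 : (Fin r × Fin s) ⊕ Fin r)) v, coord F u.1 u.2 ∈ dataAtLeft v := by
    rintro _ u rfl
    exact coord_mem_dataAtLeft u.1 u.2
  refine ⟨forward (fun u => coord F u.1 u.2)
    ((gather r (Nat.clog 2 r)).map (Transfer.pull grp pos cls lab)), ⟨?_, ?_, ?_⟩, ?_, ?_⟩
  · refine within_sendUnits (fun R hR v w hne => ?_) _
    obtain ⟨R', -, rfl⟩ := List.mem_map.1 hR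
    obtain ⟨u, hu⟩ := hne
    obtain ⟨hv, hw, -⟩ := Transfer.mem_pull.1 hu
    rcases v with ⟨j, k⟩ | j
    · rcases w with ⟨j', k'⟩ | j'
      · obtain rfl : k = k' := Option.some_injective _ (hv.trans hw.symm)
        exact ⟨j, j', k, rfl, rfl⟩
      · simp [grp, cls] at hw
    · simp [grp, cls] at hv
  · exact valid_forward hW (hga.1.pull hc h0)
  · rintro (i | j) f hf
    · obtain ⟨j, k, rfl⟩ := hf
      exact final_forward hW _ (Sum.inl i) ((j, i.2), k) (held_pull hc h0 (Sum.inl i) _ rfl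
        (hga.2 _ _ ((Fin.isLt _).trans_le (Nat.le_pow_clog one_lt_two _))))
    · exact hf.elim
  · simp [loads_forward, routeLoads, gather]
  · rw [loads_forward, sum_maxLoad_routeLoads]
    refine (sum_width_pull_le _ fun j x => ?_).trans (Nat.mul_le_mul_left m ?_)
    · refine (Finset.card_le_card_of_injOn (t := Finset.univ) (fun u => u.2)
        (fun _ _ => Finset.mem_coe.2 (Finset.mem_univ _)) fun u hu u' hu' h => ?_).trans_eq
        (Finset.card_fin m)
      simp only [Finset.coe_filter, Finset.mem_univ, true_and, Set.mem_ofPred_eq] at hu hu'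
      exact Prod.ext (Prod.ext (hu.2.trans hu'.2.symm)
        (Option.some_injective _ (hu.1.trans hu'.1.symm))) h
    · have := sum_width_gather_le (p := r) (Nat.clog 2 r)
      have := min_le_right (2 ^ Nat.clog 2 r) r
      omega

/-- Within a group of `s` nodes, the block of the broadcasting node is cut into `s - 1` pieces:
its scatter to `s - 1` of the nodes takes as many rounds as the all-gather. -/
theorem exists_broadcastWithin_reduceWithin (F : Type*) [Field F] (hs : 2 ≤ s)
    (hm : s - 1 ∣ m) :
    ∃ (R : Scheme ((Fin r × Fin s) ⊕ Fin r) F (Data F (Fin r × Fin s) m))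
      (B : Scheme ((Fin r × Fin s) ⊕ Fin r) F (Data F (Fin r) m)),
      ReduceWithin R ∧ BroadcastWithin B ∧ loads R = reverseLoads (loads B) ∧
        (loads B).length = 2 * Nat.clog 2 s ∧ ((loads B).map maxLoad).sum ≤ 2 * m := by
  obtain ⟨b, rfl⟩ := hm
  obtain ⟨Rs, hF, hheld, hgrp, hlen, hwid⟩ :=
    exists_parallel_spread (V' := (Fin r × Fin s) ⊕ Fin r) (U' := Fin r × Fin ((s - 1) * b))
    (J := Fin r) (b := b) (p := s) (r := 1) (s := s - 1) (by omega) (by omega) (by omega)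
    (grp := groupOf) (pos := Sum.map Prod.snd fun _ => 0) (cls := fun u => u.1)
    (lab := fun u => (0, u.2.divNat)) (src := fun u => Sum.inr u.1)
    (by
      constructor
      · rintro (i | j) (i' | j') u h h' hpos
        · exact congrArg Sum.inl (Prod.ext (h.trans h'.symm) (Sum.inl_injective hpos))
        · simp at hpos
        · simp at hpos
        · exact congrArg Sum.inr (h.trans h'.symm)
      · rintro (k | k) u
        · exact ⟨Sum.inl (u.1, k), rfl, rfl⟩
        · exact ⟨Sum.inr u.1, rfl, congrArg Sum.inr (Subsingleton.elim _ _)⟩)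
    (fun j x => (Finset.card_le_card fun u hu => by
      simp only [Finset.mem_filter, Finset.mem_univ, true_and, Prod.ext_iff] at hu ⊢
      exact ⟨hu.1, hu.2.2⟩).trans (card_filter_divNat_le (b := b) j x.2))
    fun u => ⟨rfl, rfl⟩
  have hW : ∀ v, ∀ u ∈ origin (fun u : Fin r × Fin ((s - 1) * b) =>
      (Sum.inr u.1 : (Fin r × Fin s) ⊕ Fin r)) v, coord F u.1 u.2 ∈ dataAtRight v := by
    rintro _ u rfl
    exact coord_mem_dataAtRight u.1 u.2
  refine ⟨collect Rs.reverse (summand fun j i => if i.1 = j then 1 else 0),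
    forward (fun u => coord F u.1 u.2) Rs, ⟨?_, ?_⟩, ⟨?_, valid_forward hW hF, ?_⟩, ?_, ?_, ?_⟩
  · exact within_collect (fun R hR v w hne => (hgrp R (List.mem_reverse.1 hR) v w hne).symm) _
  · refine multiReduce_collect_reverse hF fun i u hne => hheld _ u i.2 ?_ rfl
    by_contra h
    exact hne (if_neg h)
  · exact within_sendUnits hgrp _
  · rintro (i | j) f hf
    · obtain ⟨k, rfl⟩ := hf
      exact final_forward hW Rs (Sum.inl i) (i.1, k) (hheld _ _ i.2 rfl rfl)
    · exact hf.elim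
  · rw [loads_collect_reverse, loads_forward]
  · rw [loads_forward, routeLoads, List.length_map, hlen, Nat.sub_add_cancel (by omega), two_mul]
  · rw [loads_forward, sum_maxLoad_routeLoads]
    exact hwid.trans_eq (by ring)

theorem coord_comp_copyToGroup (i : Fin r × Fin s) (k : Fin m) :
    coord F i k ∘ₗ copyToGroup = coord F i.1 k := rfl

theorem coord_comp_partialCombination (a : Fin r → Fin r × Fin s → F) (i : Fin r × Fin s)
    (k : Fin m) : coord F i k ∘ₗ partialCombination a =
      ∑ j : Fin r, a i.1 (j, i.2) • coord F (j, i.2) k := by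
  ext x
  simp [coord, partialCombination]

theorem multiBroadcast_append {A : Scheme ((Fin r × Fin s) ⊕ Fin r) F (Data F (Fin r × Fin s) m)}
    {B : Scheme ((Fin r × Fin s) ⊕ Fin r) F (Data F (Fin r) m)} (hA : AllGatherAcross A)
    (hB : BroadcastWithin B) : MultiBroadcast (B ++ onData copyToGroup A) := by
  have h := hA.2.append_onData copyToGroup hB.2.1
    (forall_mem_dataAtLeft _ fun i k => hB.2.2 (Sum.inl i) _ ⟨k, rfl⟩)
  refine ⟨h.1, ?_⟩
  rintro (i | j) f hf
  · obtain ⟨j, k, rfl⟩ := hf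
    exact h.2 (Sum.inl i) _ ⟨_, ⟨j, k, rfl⟩, coord_comp_copyToGroup _ k⟩
  · exact hf.elim

theorem multiReduce_append {A R : Scheme ((Fin r × Fin s) ⊕ Fin r) F (Data F (Fin r × Fin s) m)}
    (hA : AllGatherAcross A) (hR : ReduceWithin R) (a : Fin r → Fin r × Fin s → F) :
    MultiReduce a (A ++ onData (partialCombination a) R) := by
  have h := hR.2.append_onData (partialCombination a) hA.2.1
    (forall_mem_dataAtLeft _ fun i k => by
      rw [coord_comp_partialCombination]
      exact Submodule.sum_mem _ fun j _ =>
        Submodule.smul_mem _ _ (hA.2.2 (Sum.inl i) _ ⟨j, k, rfl⟩))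
  refine ⟨h.1, ?_⟩
  rintro (i | j) f hf
  · exact hf.elim
  · obtain ⟨k, rfl⟩ := hf
    refine h.2 (Sum.inr j) _ ⟨_, ⟨k, rfl⟩, ?_⟩
    have hsum : (∑ i : Fin r × Fin s, (if i.1 = j then (1 : F) else 0) • coord F i k) ∘ₗ
        partialCombination a = ∑ i : Fin r × Fin s, if i.1 = j then
          (∑ j' : Fin r, a i.1 (j', i.2) • coord F (j', i.2) k) else 0 := by
      refine (map_sum (partialCombination a).dualMap _ _).trans ?_
      refine Finset.sum_congr rfl fun i _ => ?_
      split_ifs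
      · rw [one_smul]
        exact coord_comp_partialCombination a i k
      · rw [zero_smul, map_zero]
    refine hsum.trans ?_
    change _ = ∑ i, a j i • coord F i k
    rw [Fintype.sum_prod_type, Finset.sum_eq_single j (fun j' _ hj' => by simp [hj']) (by simp),
      Fintype.sum_prod_type, Finset.sum_comm]
    simp

end Groups

end CommScheme

open CommScheme
theorem mainTheorem4 :
    -- cost of multi-reduce
    (∀ p r : ℕ, r < p → ∃ d : ℕ, 0 < d ∧
      ∀ (F : Type*) [Field F] (n q : ℕ), 0 < q → d ∣ n * q →
      ∀ α β : ℝ, 0 ≤ α → 0 ≤ β →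
      ∀ a : Fin r → Fin p → F,
        ∃ S : Scheme (Fin p ⊕ Fin r) F (Data F (Fin p) (n * q)),
          MultiReduce a S ∧
          cost α β q S ≤ 2 * ((Nat.clog 2 p : ℝ) * α + (r : ℝ) * n * β)) ∧
    -- form of the scheme for `p = r * s`
    (∀ r s : ℕ, r < r * s → ∃ d : ℕ, 0 < d ∧
      ∀ (F : Type*) [Field F] (n q : ℕ), 0 < q → d ∣ n * q →
      ∀ α β : ℝ, 0 ≤ α → 0 ≤ β →
        ∃ (A R : Scheme ((Fin r × Fin s) ⊕ Fin r) F (Data F (Fin r × Fin s) (n * q)))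
          (B : Scheme ((Fin r × Fin s) ⊕ Fin r) F (Data F (Fin r) (n * q))),
          AllGatherAcross A ∧ ReduceWithin R ∧ BroadcastWithin B ∧
          loads R = reverseLoads (loads B) ∧
          MultiBroadcast (B ++ onData copyToGroup A) ∧
          cost α β q (B ++ onData copyToGroup A) ≤
            2 * ((Nat.clog 2 (r * s) : ℝ) * α + (r : ℝ) * n * β) ∧
          ∀ a : Fin r → Fin r × Fin s → F,
            MultiReduce a (A ++ onData (partialCombination a) R) ∧
            cost α β q (A ++ onData (partialCombination a) R) ≤
              2 * ((Nat.clog 2 (r * s) : ℝ) * α + (r : ℝ) * n * β)) ∧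
    -- encoding of systematic MDS codes
    (∀ P K : ℕ, K < P → P - K < K → ∃ d : ℕ, 0 < d ∧
      ∀ (F : Type*) [Field F] (N q : ℕ), K ∣ N → 0 < q → d ∣ N / K * q →
      ∀ α β : ℝ, 0 ≤ α → 0 ≤ β →
      ∀ G : Matrix (Fin K) (Fin K ⊕ Fin (P - K)) F, IsSystematicMDS G →
        ∃ S : Scheme (Fin K ⊕ Fin (P - K)) F (Data F (Fin K) (N / K * q)),
          Encodes G S ∧
          cost α β q S ≤
            2 * ((Nat.clog 2 K : ℝ) * α + ((P : ℝ) - K) * ((N : ℝ) / K) * β)) := by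
  refine ⟨fun p r h => exists_multiReduce h, fun r s h => ?_, fun P K hKP hPK => ?_⟩
  · have hr : 0 < r := Nat.pos_of_ne_zero fun h0 => by simp [h0] at h
    have hs : 2 ≤ s := by
      by_contra hs
      have := Nat.mul_le_mul_left r (show s ≤ 1 by omega)
      omega
    refine ⟨s - 1, by omega, fun F _ n q hq hd α β hα hβ => ?_⟩
    obtain ⟨A, hA, hAl, hAw⟩ := exists_allGatherAcross (s := s) (m := n * q) F hr
    obtain ⟨R, B, hR, hB, hRB, hBl, hBw⟩ := exists_broadcastWithin_reduceWithin (r := r) F hs hd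
    have hlen : Nat.clog 2 r + 2 * Nat.clog 2 s ≤ 2 * Nat.clog 2 (r * s) :=
      clog_add_two_mul_clog_le hr hs
    have hwid : n * q * (r - 1) + 2 * (n * q) ≤ 2 * (r * (n * q)) := by
      obtain ⟨t, rfl⟩ : ∃ t, r = t + 1 := ⟨r - 1, by omega⟩
      rw [Nat.add_sub_cancel]
      nlinarith [Nat.zero_le (n * q * t)]
    refine ⟨A, R, B, hA, hR, hB, hRB, multiBroadcast_append hA hB, ?_,
      fun a => ⟨multiReduce_append hA hR a, ?_⟩⟩
    · refine cost_le hα hβ hq ?_ ?_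
      · rw [loads_append, loads_onData, List.length_append]
        omega
      · rw [loads_append, loads_onData, List.map_append, List.sum_append]
        omega
    · refine cost_le hα hβ hq ?_ ?_
      · rw [loads_append, loads_onData, List.length_append, hRB]
        simp only [reverseLoads, List.length_reverse, List.length_map]
        omega
      · rw [loads_append, loads_onData, List.map_append, List.sum_append, hRB,
          sum_maxLoad_reverseLoads]
        omega
  · obtain ⟨d, hd, H⟩ := exists_multiReduce hPK
    refine ⟨d, hd, fun F _ N q hN hq hdvd α β hα hβ G hG => ?_⟩
    obtain ⟨S, hS, hcost⟩ := H F (N / K) q hq hdvd α β hα hβ fun j i => G i (Sum.inr j)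
    refine ⟨S, ⟨hS.1, ?_⟩, ?_⟩
    · rintro (i | j) f hf
      · obtain ⟨k, rfl⟩ := hf
        have hsum : coord F i k = ∑ i', G i' (Sum.inl i) • coord F i' k := by
          simp [hG.1]
        have hmem := le_final dataAtLeft S (Sum.inl i) (coord_mem_dataAtLeft i k)
        rw [hsum] at hmem
        exact hmem
      · exact hS.2 (Sum.inr j) f hf
    · rw [Nat.cast_sub hKP.le, Nat.cast_div hN (by exact_mod_cast (show K ≠ 0 by omega))] at hcost
      exact hcost
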